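/- Let $n \ge 2$ and $\nu > 0$, and let $L^2_\sigma = \{v \in L^2(\mathbb{R}^n,\mathbb{R}^n) : \operatorname{div} v = 0 \text{ in the sense of distributions}\}$ with the $L^2$ norm. For $u^0 \in L^2_\sigma$, a distributional solution of the incompressible Navier--Stokes equations in $\mathbb{R}^n \times [0,\infty)$ with viscosity $\nu$ and initial datum $u^0$ is a map $u \in L^2_{\mathrm{loc}}([0,\infty); L^2_\sigma)$ such that $$\int_0^\infty \langle u, \partial_t \varphi \rangle \, dt + \int_0^\infty \langle u \otimes u, \mathrm{D} \varphi \rangle \, dt + \nu \int_0^\infty \langle u, \Delta \varphi \rangle \, dt + \langle u^0, \varphi(\cdot,0) \rangle = 0$$ for all $\varphi \in C_c^\infty(\mathbb{R}^n \times [0,\infty), \mathbb{R}^n)$ with $\operatorname{div} \varphi = 0$, where $\langle \cdot,\cdot \rangle$ denotes integration over $\mathbb{R}^n$ of the pointwise inner product. Write $\mathcal{E}(t) = \frac12 \int_{\mathbb{R}^n} |u(x,t)|^2 \, dx$. Then: 1. For all $p \in (2,\infty)$ and $M > 0$, the set of initial data $u^0 \in L^2_\sigma$ that admit a distributional solution $u$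 with $\|u\|_{L^p((0,\infty); L^2)} \le M$ is nowhere dense in $L^2_\sigma$. 2. For all $\varepsilon, C > 0$, the set of initial data $u^0 \in L^2_\sigma$ that admit a distributional solution $u$ with $(1+t)^\varepsilon \mathcal{E}(t) \le C$ for almost every $t \in [0,\infty)$ is nowhere dense in $L^2_\sigma$. 3. For a Baire-generic $u^0 \in L^2_\sigma$ (that is, for all $u^0$ in a residual subset of $L^2_\sigma$), every distributional solution $u$ with initial datum $u^0$ satisfies $$\lim_{\tau \to \infty} \| t^\varepsilon \mathcal{E} \|_{L^\infty(\tau,\infty)} = \infty \quad \text{for every } \varepsilon > 0.$$ -/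

import Mathlib

open MeasureTheory Set Filter Topology
open scoped ContDiff

noncomputable section

namespace NavierStokes

/-- Euclidean space `ℝⁿ`. -/
abbrev Space (n : ℕ) : Type := EuclideanSpace ℝ (Fin n)

/-- The Hilbert space `L²(ℝⁿ, ℝⁿ)`. -/
abbrev L2Field (n : ℕ) : Type := Lp (Space n) 2 (volume : Measure (Space n))

theorem integrable_fderiv_apply {n : ℕ} (v : L2Field n) {φ : Space n → ℝ}
    (hφ : ContDiff ℝ ∞ φ) (hc : HasCompactSupport φ) :
    Integrable (fun x => fderiv ℝ φ x (v x)) volume := by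
  have hcont : Continuous (fderiv ℝ φ) := hφ.continuous_fderiv (by simp)
  have h1 : MemLp (fderiv ℝ φ) 2 (volume : Measure (Space n)) :=
    hcont.memLp_of_hasCompactSupport (hc.fderiv (𝕜 := ℝ))
  have h2 : MemLp (fun x => v x) 2 (volume : Measure (Space n)) := Lp.memLp v
  have h3 : Integrable (fun x => ‖fderiv ℝ φ x‖ * ‖v x‖) (volume : Measure (Space n)) :=
    h1.norm.integrable_mul h2.norm
  refine h3.mono ((ContinuousLinearMap.id ℝ (Space n →L[ℝ] ℝ)).aestronglyMeasurable_comp₂ h1.1 h2.1) (Eventually.of_forall fun x => ?_)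
  have h := (fderiv ℝ φ x).le_opNorm (v x)
  simpa [abs_of_nonneg, mul_nonneg] using h

/-- `L²_σ(ℝⁿ, ℝⁿ) = {v ∈ L² : div v = 0}`, the divergence being taken in the sense of
distributions: `∫ ∇φ · v dx = 0` for all scalar test functions `φ ∈ C_c^∞(ℝⁿ)`. -/
def L2sigma (n : ℕ) : Submodule ℝ (L2Field n) where
  carrier := {v | ∀ φ : Space n → ℝ, ContDiff ℝ ∞ φ → HasCompactSupport φ →
    ∫ x, fderiv ℝ φ x (v x) = 0}
  zero_mem' := by
    intro φ _ _
    refine integral_eq_zero_of_ae ?_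
    filter_upwards [Lp.coeFn_zero (Space n) 2 (volume : Measure (Space n))] with x hx
    rw [hx]
    simp
  add_mem' := by
    intro v w hv hw φ hφ hc
    have h : (fun x => fderiv ℝ φ x ((v + w : L2Field n) x)) =ᵐ[volume]
        fun x => fderiv ℝ φ x (v x) + fderiv ℝ φ x (w x) := by
      filter_upwards [Lp.coeFn_add v w] with x hx
      rw [hx, Pi.add_apply, map_add]
    rw [integral_congr_ae h, integral_add (integrable_fderiv_apply v hφ hc)
      (integrable_fderiv_apply w hφ hc), hv φ hφ hc, hw φ hφ hc, add_zero]
  smul_mem' := by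
    intro c v hv φ hφ hc
    have h : (fun x => fderiv ℝ φ x ((c • v : L2Field n) x)) =ᵐ[volume]
        fun x => c • fderiv ℝ φ x (v x) := by
      filter_upwards [Lp.coeFn_smul c v] with x hx
      rw [hx, Pi.smul_apply, map_smul]
    rw [integral_congr_ae h, integral_smul, hv φ hφ hc, smul_zero]

/-- The (classical) divergence of a vector field. -/
def divergence {n : ℕ} (v : Space n → Space n) (x : Space n) : ℝ :=
  ∑ i : Fin n, fderiv ℝ v x (EuclideanSpace.single i 1) i

/-- Solenoidal test fields `φ ∈ C_c^∞(ℝⁿ × [0,∞), ℝⁿ)`, `div φ = 0`, written as `φ (t, x)`.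
They are smooth up to and including `t = 0`, are not required to vanish there, and are given as
the restrictions to `t ≥ 0` of smooth compactly supported fields on the whole space-time; nothing
is asked of the divergence at times `t < 0`. -/
structure IsTestField {n : ℕ} (φ : ℝ × Space n → Space n) : Prop where
  smooth : ContDiff ℝ ∞ φ
  compactSupport : HasCompactSupport φ
  div_free : ∀ t : ℝ, 0 ≤ t → ∀ x : Space n, divergence (fun y => φ (t, y)) x = 0

/-- `u` is a distributional solution, with viscosity `ν` and initial datum `u₀`, of the
incompressible Navier-Stokes equations in `ℝⁿ × [0,∞)`: `u ∈ L²_loc([0,∞); L²_σ)` (as a Bochner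
space; only the values `u t` at times `t ≥ 0` matter) and
`∫₀^∞ ⟨u, ∂ₜφ⟩ dt + ∫₀^∞ ⟨u ⊗ u, Dφ⟩ dt + ν ∫₀^∞ ⟨u, Δφ⟩ dt + ⟨u₀, φ(0)⟩ = 0`
for all solenoidal test fields `φ`. -/
structure IsDistributionalSolution {n : ℕ} (ν : ℝ) (u₀ : L2sigma n) (u : ℝ → L2sigma n) :
    Prop where
  locally_L2 : ∀ T : ℝ, MemLp u 2 (volume.restrict (Icc 0 T))
  weak_form : ∀ φ : ℝ × Space n → Space n, IsTestField φ →
    (∫ t in Ici (0 : ℝ), ∫ x : Space n,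
        inner ℝ ((u t : L2Field n) x) (deriv (fun s => φ (s, x)) t))
    + (∫ t in Ici (0 : ℝ), ∫ x : Space n,
        inner ℝ ((u t : L2Field n) x)
          (fderiv ℝ (fun y => φ (t, y)) x ((u t : L2Field n) x)))
    + ν * (∫ t in Ici (0 : ℝ), ∫ x : Space n,
        inner ℝ ((u t : L2Field n) x) (Laplacian.laplacian (fun y => φ (t, y)) x))
    + (∫ x : Space n, inner ℝ ((u₀ : L2Field n) x) (φ (0, x))) = 0

/-- The kinetic energy `½ ∫ |v(x)|² dx`. -/
def energy {n : ℕ} (v : L2sigma n) : ℝ :=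
  (1 / 2) * ∫ x : Space n, ‖(v : L2Field n) x‖ ^ 2

end NavierStokes

end

namespace NavierStokes

/-! ### Compactly supported solenoidal fields -/

variable {n : ℕ}

/-! Test the equation with a fixed solenoidal `ψ`, spread out to `ψ_l(x) = l^{n/2} ψ(l x)` and cut
off in time at `l⁻²`. The `L²` norm of `ψ_l` does not depend on `l`. The time derivative and the
Laplacian each gain `l²`, and for `n ≥ 2`, `l ≤ 1` the gradient is `O(l²)` uniformly in space. Hence
`|⟨u₀, ψ_l⟩|` is at most a constant times the mean of `‖u‖ + ‖u‖²` over `[0, l⁻²]`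
(`exists_abs_integral_inner_rescale_le`).

If a set of data has solutions with uniformly decaying mean energy, `⟨u₀, ψ_l⟩` is therefore
uniformly small on it for small `l`. This inequality passes to the closure but fails on every ball,
since one may move by a fixed multiple of `ψ_l` inside it (`isNowhereDense_of_mean_energy_decay`).
An `L^p` bound with `p > 2` and algebraic decay both force such mean decay; the generic statement
follows by a countable union. -/

theorem integral_fderiv_apply_eq_zero {ψ : Space n → Space n} (hψ : ContDiff ℝ ∞ ψ)
    (hc : HasCompactSupport ψ) (hdiv : ∀ x, divergence ψ x = 0) {φ : Space n → ℝ}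
    (hφ : ContDiff ℝ ∞ φ) :
    ∫ x, fderiv ℝ φ x (ψ x) = 0 := by
  have hψd : Differentiable ℝ ψ := hψ.differentiable (by simp)
  have hφd : Differentiable ℝ φ := hφ.differentiable (by simp)
  have hφ' : Continuous (fderiv ℝ φ) := hφ.continuous_fderiv (by simp)
  have hψ' : Continuous (fderiv ℝ ψ) := hψ.continuous_fderiv (by simp)
  have hfi : ∀ i : Fin n, ∀ x, HasFDerivAt (fun x => ψ x i)
      ((EuclideanSpace.proj i : Space n →L[ℝ] ℝ).comp (fderiv ℝ ψ x)) x := fun i x =>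
    (EuclideanSpace.proj i : Space n →L[ℝ] ℝ).hasFDerivAt.comp x (hψd x).hasFDerivAt
  have hci : ∀ i : Fin n, Continuous fun x => ψ x i := fun i =>
    continuous_iff_continuousAt.2 fun x => (hfi i x).continuousAt
  have hsi : ∀ i : Fin n, HasCompactSupport fun x => ψ x i := fun i =>
    hc.comp_left (g := fun y : Space n => y i) rfl
  have hf : ∀ (i : Fin n) (x : Space n), fderiv ℝ (fun x => ψ x i) x (EuclideanSpace.single i 1)
      = fderiv ℝ ψ x (EuclideanSpace.single i 1) i := by
    intro i x
    rw [(hfi i x).fderiv]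
    rfl
  have hcd : ∀ i : Fin n, Continuous fun x => fderiv ℝ (fun x => ψ x i) x
      (EuclideanSpace.single i 1) := by
    intro i
    simp_rw [hf]
    exact (EuclideanSpace.proj i : Space n →L[ℝ] ℝ).continuous.comp
      (hψ'.clm_apply continuous_const)
  have hsd : ∀ i : Fin n, HasCompactSupport fun x => fderiv ℝ (fun x => ψ x i) x
      (EuclideanSpace.single i 1) := fun i => (hsi i).fderiv_apply (𝕜 := ℝ) _
  have hI : ∀ i : Fin n, Integrable fun x =>
      ψ x i * fderiv ℝ φ x (EuclideanSpace.single i 1) := fun i =>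
    ((hci i).mul (hφ'.clm_apply continuous_const)).integrable_of_hasCompactSupport
      (hsi i).mul_right
  have hJ : ∀ i : Fin n, Integrable fun x =>
      fderiv ℝ (fun x => ψ x i) x (EuclideanSpace.single i 1) * φ x := fun i =>
    ((hcd i).mul hφ.continuous).integrable_of_hasCompactSupport (hsd i).mul_right
  -- `φ` need not have compact support: the support of `ψ` removes all boundary terms.
  have hib : ∀ i : Fin n, ∫ x, ψ x i * fderiv ℝ φ x (EuclideanSpace.single i 1)
      = - ∫ x, fderiv ℝ (fun x => ψ x i) x (EuclideanSpace.single i 1) * φ x := by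
    intro i
    refine integral_mul_fderiv_eq_neg_fderiv_mul_of_integrable ?_ ?_ ?_
      (fun x _ => (hfi i x).differentiableAt) (fun x _ => hφd x)
    · exact hJ i
    · exact hI i
    · exact ((hci i).mul hφ.continuous).integrable_of_hasCompactSupport (hsi i).mul_right
  have hexp : ∀ x, fderiv ℝ φ x (ψ x)
      = ∑ i, ψ x i * fderiv ℝ φ x (EuclideanSpace.single i 1) := by
    intro x
    have h := (EuclideanSpace.basisFun (Fin n) ℝ).sum_repr (ψ x)
    conv_lhs => rw [← h]
    simp
  simp_rw [hexp]
  rw [integral_finsetSum _ fun i _ => hI i]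
  simp_rw [hib]
  rw [Finset.sum_neg_distrib, ← integral_finsetSum _ fun i _ => hJ i]
  simp_rw [← Finset.sum_mul, hf]
  have : ∀ x, ∑ i : Fin n, fderiv ℝ ψ x (EuclideanSpace.single i 1) i = 0 := hdiv
  simp [this]

/-- Compactly supported smooth solenoidal fields exist in dimension at least two. -/
theorem exists_solenoidal_field (hn : 2 ≤ n) :
    ∃ ψ : Space n → Space n, ContDiff ℝ ∞ ψ ∧ HasCompactSupport ψ ∧
      (∀ x, divergence ψ x = 0) ∧ ∃ x, ψ x ≠ 0 := by
  obtain ⟨i, j, hij⟩ : ∃ i j : Fin n, i ≠ j :=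
    ⟨⟨0, by omega⟩, ⟨1, by omega⟩, by simp⟩
  let η : ContDiffBump (0 : Space n) := ⟨1, 2, by norm_num, by norm_num⟩
  have hη : ContDiff ℝ ∞ (η : Space n → ℝ) := η.contDiff
  have hη' : ContDiff ℝ ∞ (fderiv ℝ (η : Space n → ℝ)) := hη.fderiv_right (by simp)
  have hηd : Differentiable ℝ (fderiv ℝ (η : Space n → ℝ)) := hη'.differentiable (by simp)
  let e : Fin n → Space n := fun k => EuclideanSpace.single k 1
  -- A rotated gradient in the `(i, j)` plane: its divergence is a difference of mixed second
  -- derivatives of `η`.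
  let ψ : Space n → Space n := fun x =>
    fderiv ℝ η x (e j) • e i - fderiv ℝ η x (e i) • e j
  have hder : ∀ x, HasFDerivAt ψ
      (((fderiv ℝ (fderiv ℝ (η : Space n → ℝ)) x).flip (e j)).smulRight (e i) -
        ((fderiv ℝ (fderiv ℝ (η : Space n → ℝ)) x).flip (e i)).smulRight (e j)) x := by
    intro x
    have h : ∀ k, HasFDerivAt (fun x => fderiv ℝ η x (e k))
        ((fderiv ℝ (fderiv ℝ (η : Space n → ℝ)) x).flip (e k)) x := by
      intro k
      have := (hηd x).hasFDerivAt.clm_apply (hasFDerivAt_const (e k) x)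
      simpa using this
    exact ((h j).smul_const (e i)).sub ((h i).smul_const (e j))
  refine ⟨ψ, ?_, ?_, ?_, ?_⟩
  · exact ((hη'.clm_apply contDiff_const).smul contDiff_const).sub
      ((hη'.clm_apply contDiff_const).smul contDiff_const)
  · exact (η.hasCompactSupport.fderiv (𝕜 := ℝ)).comp_left
      (g := fun l : Space n →L[ℝ] ℝ => l (e j) • e i - l (e i) • e j) (by simp)
  · intro x
    have hs : IsSymmSndFDerivAt ℝ (η : Space n → ℝ) x :=
      hη.contDiffAt.isSymmSndFDerivAt (by simpa using ENat.LEInfty.out)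
    have hs' := hs.eq (e i) (e j)
    unfold divergence
    rw [(hder x).fderiv]
    simp only [_root_.sub_apply, ContinuousLinearMap.smulRight_apply,
      ContinuousLinearMap.flip_apply, PiLp.sub_apply, PiLp.smul_apply, smul_eq_mul,
      Finset.sum_sub_distrib]
    rw [Finset.sum_eq_single i, Finset.sum_eq_single j]
    · simp [e] at hs' ⊢
      linarith
    all_goals simp +contextual [e]
  · by_contra! h
    have h0 : ∀ x, fderiv ℝ η x (e j) = 0 := by
      intro x
      have := congrArg (fun y : Space n => y i) (h x)
      simpa [ψ, e, hij] using this
    -- If `ψ` vanished, `η` would be constant along the `j` axis, yet it is 1 at the origin and 0 at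
    -- distance 3.
    have hd : ∀ s : ℝ, HasDerivAt (fun s : ℝ => η (s • e j)) 0 s := by
      intro s
      have h1 : HasDerivAt (fun s : ℝ => s • e j) (e j) s := by
        simpa using (hasDerivAt_id s).smul_const (e j)
      have h2 := ((hη.differentiable (by simp)) (s • e j)).hasFDerivAt.comp_hasDerivAt s h1
      rwa [h0] at h2
    have hconst := is_const_of_deriv_eq_zero (fun s => (hd s).differentiableAt)
      (fun s => (hd s).deriv) 0 3
    have hA : η ((0 : ℝ) • e j) = 1 := η.one_of_mem_closedBall (by simp [η])
    have hB : η ((3 : ℝ) • e j) = 0 := by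
      apply η.zero_of_le_dist
      simp [η, e, norm_smul]
      norm_num
    rw [hA, hB] at hconst
    norm_num at hconst

/-! ### Rescaling -/

/-- The `L²`-invariant rescaling `l^{n/2} f(l x)`. -/
noncomputable def rescale (l : ℝ) (f : Space n → Space n) (x : Space n) : Space n :=
  √(l ^ n) • f (l • x)

theorem hasCompactSupport_rescale {l : ℝ} (hl : 0 < l) {f : Space n → Space n}
    (hf : HasCompactSupport f) : HasCompactSupport (rescale l f) := by
  have : HasCompactSupport fun x => f (l • x) := hf.comp_smul hl.ne'
  exact this.smul_left (f := fun _ => √(l ^ n))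

theorem contDiff_rescale (l : ℝ) {f : Space n → Space n} (hf : ContDiff ℝ ∞ f) :
    ContDiff ℝ ∞ (rescale l f) :=
  (hf.comp (contDiff_const_smul l)).const_smul _

theorem fderiv_rescale (l : ℝ) {f : Space n → Space n} (hf : Differentiable ℝ f) (x : Space n) :
    fderiv ℝ (rescale l f) x = √(l ^ n) • l • fderiv ℝ f (l • x) := by
  have h : DifferentiableAt ℝ (fun y => f (l • y)) x :=
    (hf _).comp x (differentiableAt_id.const_smul l)
  have := fderiv_fun_const_smul h (√(l ^ n))
  rw [← fderiv_comp_smul]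
  exact this

theorem divergence_const_smul (c : ℝ) {f : Space n → Space n} (hf : Differentiable ℝ f)
    (x : Space n) : divergence (fun y => c • f y) x = c * divergence f x := by
  simp only [divergence]
  rw [fderiv_fun_const_smul (hf x), Finset.mul_sum]
  simp

theorem divergence_rescale (l : ℝ) {f : Space n → Space n} (hf : Differentiable ℝ f)
    (x : Space n) : divergence (rescale l f) x = √(l ^ n) * l * divergence f (l • x) := by
  simp only [divergence, fderiv_rescale l hf, Finset.mul_sum]
  simp [mul_assoc]

theorem laplacian_rescale (l : ℝ) {f : Space n → Space n} (hf : ContDiff ℝ ∞ f) (x : Space n) :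
    Laplacian.laplacian (rescale l f) x = l ^ 2 • rescale l (Laplacian.laplacian f) x := by
  have hg : ContDiff ℝ 2 (fun y => f (l • y)) :=
    (hf.comp (contDiff_const_smul l)).of_le ENat.LEInfty.out
  have h1 := InnerProductSpace.laplacian_smul (√(l ^ n)) hg.contDiffAt (x := x)
  change Laplacian.laplacian ((√(l ^ n)) • fun y => f (l • y)) x = _
  rw [h1, rescale, smul_comm]
  congr 1
  simp only [InnerProductSpace.laplacian_eq_iteratedFDeriv_stdOrthonormalBasis]
  rw [Finset.smul_sum]
  refine Finset.sum_congr rfl fun i _ => ?_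
  have h2 : fderiv ℝ (fun y => f (l • y)) = fun y => l • fderiv ℝ f (l • y) :=
    funext fun y => fderiv_comp_smul l
  have h3 : Differentiable ℝ (fderiv ℝ f) :=
    (hf.fderiv_right (m := ∞) (by simp)).differentiable (by simp)
  have h4 : DifferentiableAt ℝ (fun y => fderiv ℝ f (l • y)) x :=
    (h3 _).comp x (differentiableAt_id.const_smul l)
  rw [iteratedFDeriv_two_apply, iteratedFDeriv_two_apply, h2, fderiv_fun_const_smul h4,
    fderiv_comp_smul (f := fderiv ℝ f)]
  simp [sq, smul_smul]

theorem continuous_laplacian {f : Space n → Space n} (hf : ContDiff ℝ ∞ f) :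
    Continuous (Laplacian.laplacian f) := by
  rw [InnerProductSpace.laplacian_eq_iteratedFDeriv_stdOrthonormalBasis]
  have : Continuous (iteratedFDeriv ℝ 2 f) := hf.continuous_iteratedFDeriv ENat.LEInfty.out
  fun_prop

theorem hasCompactSupport_laplacian {f : Space n → Space n} (hf : HasCompactSupport f) :
    HasCompactSupport (Laplacian.laplacian f) := by
  rw [InnerProductSpace.laplacian_eq_iteratedFDeriv_stdOrthonormalBasis]
  refine (hf.iteratedFDeriv (𝕜 := ℝ) 2).mono fun x hx h => hx ?_
  simp [h]

theorem integral_norm_sq_rescale {l : ℝ} (hl : 0 < l) (f : Space n → Space n) :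
    ∫ x, ‖rescale l f x‖ ^ 2 = ∫ x, ‖f x‖ ^ 2 := by
  have h1 : ∀ x, ‖rescale l f x‖ ^ 2 = l ^ n * ‖f (l • x)‖ ^ 2 := by
    intro x
    rw [rescale, norm_smul, mul_pow, Real.norm_of_nonneg (Real.sqrt_nonneg _),
      Real.sq_sqrt (by positivity)]
  simp_rw [h1]
  rw [integral_const_mul, Measure.integral_comp_smul volume (fun x => ‖f x‖ ^ 2) l]
  have : 0 < l ^ n := by positivity
  simp only [finrank_euclideanSpace, Fintype.card_fin, smul_eq_mul, abs_inv, abs_of_pos this]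
  field_simp

/-! ### Pairings in `L²` and time integrals -/

theorem norm_sq_eq_integral (v : L2Field n) : ‖v‖ ^ 2 = ∫ x, ‖v x‖ ^ 2 := by
  rw [← real_inner_self_eq_norm_sq, L2.inner_def]
  simp

theorem integrable_norm_sq (v : L2Field n) : Integrable fun x => ‖v x‖ ^ 2 :=
  (Lp.memLp v).integrable_norm_pow (by simp)

theorem integral_inner_eq_inner_toLp (v : L2Field n) {g : Space n → Space n} (hg : MemLp g 2) :
    ∫ x, inner ℝ (v x) (g x) = inner ℝ v (hg.toLp g) := by
  rw [L2.inner_def]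
  refine integral_congr_ae ?_
  filter_upwards [hg.coeFn_toLp] with x hx
  rw [hx]

theorem norm_sq_toLp_eq_integral {g : Space n → Space n} (hg : MemLp g 2) :
    ‖hg.toLp g‖ ^ 2 = ∫ x, ‖g x‖ ^ 2 := by
  rw [norm_sq_eq_integral]
  refine integral_congr_ae ?_
  filter_upwards [hg.coeFn_toLp] with x hx
  rw [hx]

theorem abs_integral_inner_le (v : L2Field n) {g : Space n → Space n} (hg : MemLp g 2) :
    |∫ x, inner ℝ (v x) (g x)| ≤ ‖v‖ * √(∫ x, ‖g x‖ ^ 2) := by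
  rw [integral_inner_eq_inner_toLp v hg, ← norm_sq_toLp_eq_integral hg,
    Real.sqrt_sq (norm_nonneg _)]
  exact abs_real_inner_le_norm _ _

theorem abs_integral_inner_apply_le (v : L2Field n) {A : Space n → Space n →L[ℝ] Space n}
    {B : ℝ} (hA : ∀ x, ‖A x‖ ≤ B) :
    |∫ x, inner ℝ (v x) (A x (v x))| ≤ B * ‖v‖ ^ 2 := by
  rw [norm_sq_eq_integral, ← integral_const_mul, ← Real.norm_eq_abs]
  refine norm_integral_le_of_norm_le ((integrable_norm_sq v).const_mul B)
    (Eventually.of_forall fun x => ?_)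
  calc ‖inner ℝ (v x) (A x (v x))‖ ≤ ‖v x‖ * ‖A x (v x)‖ := norm_inner_le_norm _ _
    _ ≤ ‖v x‖ * (B * ‖v x‖) := by
      gcongr
      exact (A x).le_of_opNorm_le (hA x) _
    _ = B * ‖v x‖ ^ 2 := by ring

theorem abs_setIntegral_Ici_le {f g : ℝ → ℝ} {T : ℝ} (hg : IntegrableOn g (Icc 0 T))
    (h : ∀ t ∈ Icc 0 T, |f t| ≤ g t) (h0 : ∀ t, T < t → f t = 0) :
    |∫ t in Ici (0 : ℝ), f t| ≤ ∫ t in Icc 0 T, g t := by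
  have : ∫ t in Ici (0 : ℝ), f t = ∫ t in Icc 0 T, f t :=
    setIntegral_eq_of_subset_of_forall_sdiff_eq_zero measurableSet_Ici Icc_subset_Ici_self
      fun t ht => h0 t (by
        by_contra! hT
        exact ht.2 ⟨ht.1, hT⟩)
  rw [this, ← Real.norm_eq_abs]
  exact norm_integral_le_of_norm_le hg
    ((ae_restrict_iff' measurableSet_Icc).2 (Eventually.of_forall h))

/-! ### Rescaled test fields and the key estimate -/

/-- The test field `χ(l² t) l^{n/2} ψ(l x)`. -/
noncomputable def rescaledTestField (χ : ℝ → ℝ) (l : ℝ) (ψ : Space n → Space n)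
    (p : ℝ × Space n) : Space n :=
  χ (l ^ 2 * p.1) • rescale l ψ p.2

theorem isTestField_rescaledTestField {χ : ℝ → ℝ} (hχ : ContDiff ℝ ∞ χ)
    (hχc : HasCompactSupport χ) {l : ℝ} (hl : 0 < l) {ψ : Space n → Space n}
    (hψ : ContDiff ℝ ∞ ψ) (hψc : HasCompactSupport ψ) (hdiv : ∀ x, divergence ψ x = 0) :
    IsTestField (rescaledTestField χ l ψ) where
  smooth := by
    have h1 : ContDiff ℝ ∞ fun p : ℝ × Space n => χ (l ^ 2 * p.1) :=
      hχ.comp (contDiff_const.mul contDiff_fst)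
    exact h1.smul ((contDiff_rescale l hψ).comp contDiff_snd)
  compactSupport := by
    have h1 : HasCompactSupport fun t => χ (l ^ 2 * t) := by
      have := hχc.comp_smul (c := l ^ 2) (by positivity)
      exact this
    have h2 := hasCompactSupport_rescale hl hψc
    refine HasCompactSupport.intro (h1.isCompact.prod h2.isCompact) fun p hp => ?_
    rw [mem_prod, not_and_or] at hp
    rcases hp with hp | hp
    · have : χ (l ^ 2 * p.1) = 0 :=
        image_eq_zero_of_notMem_tsupport (f := fun t => χ (l ^ 2 * t)) hp
      simp [rescaledTestField, this]
    · simp [rescaledTestField, image_eq_zero_of_notMem_tsupport hp]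
  div_free := by
    intro t _ x
    have hd : Differentiable ℝ (rescale l ψ) := (contDiff_rescale l hψ).differentiable (by simp)
    have := divergence_const_smul (χ (l ^ 2 * t)) hd x
    rw [divergence_rescale l (hψ.differentiable (by simp)), hdiv] at this
    simpa [rescaledTestField] using this

theorem deriv_rescaledTestField {χ : ℝ → ℝ} (hχ : Differentiable ℝ χ) (l : ℝ)
    (ψ : Space n → Space n) (t : ℝ) (x : Space n) :
    deriv (fun s => rescaledTestField χ l ψ (s, x)) t
      = (l ^ 2 * deriv χ (l ^ 2 * t)) • rescale l ψ x := by
  have h1 : HasDerivAt (fun s => χ (l ^ 2 * s)) (deriv χ (l ^ 2 * t) * (l ^ 2 * 1)) t :=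
    (hχ _).hasDerivAt.comp t ((hasDerivAt_id t).const_mul (l ^ 2))
  rw [mul_one, mul_comm] at h1
  exact (h1.smul_const (rescale l ψ x)).deriv

theorem fderiv_rescaledTestField (χ : ℝ → ℝ) (l : ℝ) {ψ : Space n → Space n}
    (hψ : ContDiff ℝ ∞ ψ) (t : ℝ) (x : Space n) :
    fderiv ℝ (fun y => rescaledTestField χ l ψ (t, y)) x
      = χ (l ^ 2 * t) • √(l ^ n) • l • fderiv ℝ ψ (l • x) := by
  have hd : Differentiable ℝ (rescale l ψ) := (contDiff_rescale l hψ).differentiable (by simp)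
  have h := fderiv_fun_const_smul (hd x) (χ (l ^ 2 * t))
  rw [fderiv_rescale l (hψ.differentiable (by simp))] at h
  exact h

theorem laplacian_rescaledTestField (χ : ℝ → ℝ) (l : ℝ) {ψ : Space n → Space n}
    (hψ : ContDiff ℝ ∞ ψ) (t : ℝ) (x : Space n) :
    Laplacian.laplacian (fun y => rescaledTestField χ l ψ (t, y)) x
      = (χ (l ^ 2 * t) * l ^ 2) • rescale l (Laplacian.laplacian ψ) x := by
  have hd : ContDiffAt ℝ 2 (rescale l ψ) x :=
    (contDiff_rescale l hψ).contDiffAt.of_le ENat.LEInfty.out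
  have h := InnerProductSpace.laplacian_smul (χ (l ^ 2 * t)) hd
  rw [laplacian_rescale l hψ, smul_smul] at h
  exact h

/-- The left side is the factor gained by the gradient under rescaling; `n ≥ 2` brings the
convective term to the same order `l²` as the linear ones. -/
theorem sqrt_pow_mul_le_sq (hn : 2 ≤ n) {l : ℝ} (hl : 0 < l) (hl1 : l ≤ 1) :
    √(l ^ n) * l ≤ l ^ 2 := by
  have : √(l ^ n) ≤ l := by
    rw [Real.sqrt_le_left hl.le]
    exact pow_le_pow_of_le_one hl.le hl1 hn
  nlinarith

/-- The weak form is solved for the initial term. `C` depends only on `ν`, `ψ` and the cutoff, so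
the estimate is uniform in the scale, the datum and the solution. -/
theorem exists_abs_integral_inner_rescale_le (hn : 2 ≤ n) {ν : ℝ} (hν : 0 < ν)
    {ψ : Space n → Space n} (hψ : ContDiff ℝ ∞ ψ) (hψc : HasCompactSupport ψ)
    (hdiv : ∀ x, divergence ψ x = 0) :
    ∃ C : ℝ, 0 < C ∧ ∀ l : ℝ, 0 < l → l ≤ 1 → ∀ (u₀ : L2sigma n) (u : ℝ → L2sigma n),
      IsDistributionalSolution ν u₀ u →
      |∫ x, inner ℝ ((u₀ : L2Field n) x) (rescale l ψ x)| ≤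
        C * l ^ 2 * ∫ t in Icc 0 (l ^ 2)⁻¹, (‖u t‖ + ‖u t‖ ^ 2) := by
  -- `χ 0 = 1` leaves exactly `rescale l ψ` in the initial term, and outer radius 1 stops the time
  -- integrals at `l⁻²`.
  let χ : ContDiffBump (0 : ℝ) := ⟨1 / 2, 1, by norm_num, by norm_num⟩
  have hχ : ContDiff ℝ ∞ (χ : ℝ → ℝ) := χ.contDiff
  have hχ0 : χ 0 = 1 := χ.one_of_mem_closedBall (by simp [χ])
  have hχ1 : ∀ s, |χ s| ≤ 1 := fun s => by
    rw [abs_of_nonneg χ.nonneg]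
    exact χ.le_one
  have hχz : ∀ s, 1 < s → χ s = 0 := fun s hs => χ.zero_of_le_dist (by
    simpa [χ] using hs.le.trans (le_abs_self s))
  have hχz' : ∀ s, 1 < s → deriv χ s = 0 := fun s hs => by
    have : (χ : ℝ → ℝ) =ᶠ[𝓝 s] fun _ => 0 := by
      filter_upwards [lt_mem_nhds hs] with r hr using hχz r hr
    rw [this.deriv_eq, deriv_const]
  obtain ⟨B₁, hB₁⟩ := (hχ.continuous_deriv (by simp)).bounded_above_of_compact_support
    χ.hasCompactSupport.deriv
  obtain ⟨B₂, hB₂⟩ := (hψ.continuous_fderiv (by simp)).bounded_above_of_compact_support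
    (hψc.fderiv (𝕜 := ℝ))
  have hB₁0 : 0 ≤ B₁ := (norm_nonneg _).trans (hB₁ 0)
  have hB₂0 : 0 ≤ B₂ := (norm_nonneg _).trans (hB₂ 0)
  set N := √(∫ x, ‖ψ x‖ ^ 2) with hN
  set N' := √(∫ x, ‖Laplacian.laplacian ψ x‖ ^ 2) with hN'
  have hN0 : 0 ≤ N := Real.sqrt_nonneg _
  have hN'0 : 0 ≤ N' := Real.sqrt_nonneg _
  refine ⟨B₁ * N + B₂ + ν * N' + 1, by positivity, fun l hl hl1 u₀ u hu => ?_⟩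
  set T := (l ^ 2)⁻¹ with hT
  have hTl : ∀ t, T < t → 1 < l ^ 2 * t := fun t ht => by
    rwa [hT, inv_lt_iff_one_lt_mul₀' (by positivity)] at ht
  have hu2 : IntegrableOn (fun t => ‖u t‖ ^ 2) (Icc 0 T) :=
    (hu.locally_L2 T).integrable_norm_pow (by simp)
  have hu1 : IntegrableOn (fun t => ‖u t‖) (Icc 0 T) :=
    ((hu.locally_L2 T).integrable (by simp)).norm
  have hψm : MemLp (rescale l ψ) 2 :=
    (contDiff_rescale l hψ).continuous.memLp_of_hasCompactSupport
      (hasCompactSupport_rescale hl hψc)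
  have hΔm : MemLp (rescale l (Laplacian.laplacian ψ)) 2 := by
    refine Continuous.memLp_of_hasCompactSupport ?_
      (hasCompactSupport_rescale hl (hasCompactSupport_laplacian hψc))
    have : Continuous fun x : Space n => l • x := continuous_const_smul l
    exact ((continuous_laplacian hψ).comp this).const_smul (√(l ^ n))
  have hweak := hu.weak_form _
    (isTestField_rescaledTestField hχ χ.hasCompactSupport hl hψ hψc hdiv)
  have hinit : ∀ x, rescaledTestField χ l ψ (0, x) = rescale l ψ x := fun x => by
    simp [rescaledTestField, hχ0]
  simp_rw [hinit] at hweak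
  have h₁ : |∫ t in Ici (0 : ℝ), ∫ x : Space n, inner ℝ ((u t : L2Field n) x)
      (deriv (fun s => rescaledTestField χ l ψ (s, x)) t)|
      ≤ ∫ t in Icc 0 T, l ^ 2 * (B₁ * N) * ‖u t‖ := by
    have he : ∀ t, ∫ x : Space n, inner ℝ ((u t : L2Field n) x)
        (deriv (fun s => rescaledTestField χ l ψ (s, x)) t)
        = l ^ 2 * deriv χ (l ^ 2 * t) *
          ∫ x : Space n, inner ℝ ((u t : L2Field n) x) (rescale l ψ x) := by
      intro t
      simp_rw [deriv_rescaledTestField (hχ.differentiable (by simp)), inner_smul_right,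
        integral_const_mul]
    simp_rw [he]
    refine abs_setIntegral_Ici_le (hu1.const_mul _) (fun t _ => ?_) fun t ht => by
      simp [hχz' _ (hTl t ht)]
    have h2 := abs_integral_inner_le (u t : L2Field n) hψm
    rw [integral_norm_sq_rescale hl, ← hN] at h2
    rw [abs_mul, abs_mul, abs_of_nonneg (sq_nonneg l)]
    calc l ^ 2 * |deriv χ (l ^ 2 * t)| * |∫ x, inner ℝ ((u t : L2Field n) x) (rescale l ψ x)|
        ≤ l ^ 2 * B₁ * (‖u t‖ * N) := by
          gcongr
          · exact hB₁ _
          · exact h2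
      _ = _ := by ring
  have h₂ : |∫ t in Ici (0 : ℝ), ∫ x : Space n, inner ℝ ((u t : L2Field n) x)
      (fderiv ℝ (fun y => rescaledTestField χ l ψ (t, y)) x ((u t : L2Field n) x))|
      ≤ ∫ t in Icc 0 T, l ^ 2 * B₂ * ‖u t‖ ^ 2 := by
    simp_rw [fderiv_rescaledTestField _ _ hψ]
    refine abs_setIntegral_Ici_le (hu2.const_mul _) (fun t _ => ?_) fun t ht => by
      simp [hχz _ (hTl t ht)]
    refine abs_integral_inner_apply_le (u t : L2Field n) (B := l ^ 2 * B₂)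
      (A := fun x => χ (l ^ 2 * t) • √(l ^ n) • l • fderiv ℝ ψ (l • x)) fun x => ?_
    rw [norm_smul, norm_smul, norm_smul, Real.norm_of_nonneg (Real.sqrt_nonneg _),
      Real.norm_of_nonneg hl.le]
    calc ‖χ (l ^ 2 * t)‖ * (√(l ^ n) * (l * ‖fderiv ℝ ψ (l • x)‖))
        ≤ 1 * (√(l ^ n) * (l * B₂)) := by
          gcongr
          · exact hχ1 _
          · exact hB₂ _
      _ = √(l ^ n) * l * B₂ := by ring
      _ ≤ l ^ 2 * B₂ := by
          gcongr
          exact sqrt_pow_mul_le_sq hn hl hl1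
  have h₃ : |∫ t in Ici (0 : ℝ), ∫ x : Space n, inner ℝ ((u t : L2Field n) x)
      (Laplacian.laplacian (fun y => rescaledTestField χ l ψ (t, y)) x)|
      ≤ ∫ t in Icc 0 T, l ^ 2 * N' * ‖u t‖ := by
    have he : ∀ t, ∫ x : Space n, inner ℝ ((u t : L2Field n) x)
        (Laplacian.laplacian (fun y => rescaledTestField χ l ψ (t, y)) x)
        = χ (l ^ 2 * t) * l ^ 2 *
          ∫ x : Space n, inner ℝ ((u t : L2Field n) x) (rescale l (Laplacian.laplacian ψ) x) := by
      intro t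
      simp_rw [laplacian_rescaledTestField _ _ hψ, inner_smul_right, integral_const_mul]
    simp_rw [he]
    refine abs_setIntegral_Ici_le (hu1.const_mul _) (fun t _ => ?_) fun t ht => by
      simp [hχz _ (hTl t ht)]
    have h2 := abs_integral_inner_le (u t : L2Field n) hΔm
    rw [integral_norm_sq_rescale hl, ← hN'] at h2
    rw [abs_mul, abs_mul, abs_of_nonneg (sq_nonneg l)]
    calc |χ (l ^ 2 * t)| * l ^ 2 *
          |∫ x, inner ℝ ((u t : L2Field n) x) (rescale l (Laplacian.laplacian ψ) x)|
        ≤ 1 * l ^ 2 * (‖u t‖ * N') := by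
          gcongr
          · exact hχ1 _
          · exact h2
      _ = _ := by ring
  rw [integral_const_mul] at h₁ h₂ h₃
  rw [integral_add hu1 hu2]
  have hI1 : 0 ≤ ∫ t in Icc 0 T, ‖u t‖ := integral_nonneg fun t => norm_nonneg _
  have hI2 : 0 ≤ ∫ t in Icc 0 T, ‖u t‖ ^ 2 := integral_nonneg fun t => by positivity
  have h₃' := mul_le_mul_of_nonneg_left h₃ hν.le
  rw [eq_neg_of_add_eq_zero_right hweak, abs_neg]
  refine (abs_add_three _ _ _).trans ?_
  rw [abs_mul, abs_of_pos hν]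
  refine (add_le_add (add_le_add h₁ h₂) h₃').trans ?_
  -- The slack left when the separate coefficients of the two integrals are replaced by the common
  -- constant.
  have e1 : 0 ≤ l ^ 2 * (B₂ + 1) * ∫ t in Icc 0 T, ‖u t‖ := by positivity
  have e2 : 0 ≤ l ^ 2 * (B₁ * N + ν * N' + 1) * ∫ t in Icc 0 T, ‖u t‖ ^ 2 := by positivity
  linarith

/-! ### Mean energy decay implies nowhere density -/

theorem setIntegral_norm_add_sq_le {E : Type*} [NormedAddCommGroup E] {u : ℝ → E} {T η : ℝ}
    (hT : 0 ≤ T) (hη : 0 < η) (hu : MemLp u 2 (volume.restrict (Icc 0 T))) :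
    ∫ t in Icc 0 T, (‖u t‖ + ‖u t‖ ^ 2)
      ≤ η * T + (η⁻¹ + 1) * ∫ t in Icc 0 T, ‖u t‖ ^ 2 := by
  have hu2 : IntegrableOn (fun t => ‖u t‖ ^ 2) (Icc 0 T) := hu.integrable_norm_pow (by simp)
  have hu1 : IntegrableOn (fun t => ‖u t‖) (Icc 0 T) := (hu.integrable (by simp)).norm
  have hc : IntegrableOn (fun _ : ℝ => η) (Icc 0 T) := integrableOn_const (by simp)
  have h1 : ∫ t in Icc 0 T, (‖u t‖ + ‖u t‖ ^ 2)
      ≤ ∫ t in Icc 0 T, (η + (η⁻¹ + 1) * ‖u t‖ ^ 2) := by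
    refine integral_mono (hu1.add hu2) (hc.add (hu2.const_mul _)) fun t => ?_
    have h2 : ‖u t‖ ≤ η + η⁻¹ * ‖u t‖ ^ 2 := by
      rcases le_total ‖u t‖ η with h | h
      · have : 0 ≤ η⁻¹ * ‖u t‖ ^ 2 := by positivity
        linarith
      · have : ‖u t‖ ≤ η⁻¹ * ‖u t‖ ^ 2 := by
          rw [inv_mul_eq_div, le_div_iff₀ hη, sq]
          gcongr
        linarith
    show ‖u t‖ + ‖u t‖ ^ 2 ≤ η + (η⁻¹ + 1) * ‖u t‖ ^ 2
    linarith
  refine h1.trans_eq ?_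
  rw [integral_add hc (hu2.const_mul _), integral_const_mul, setIntegral_const]
  simp [hT, mul_comm]

/-- A set of data admitting solutions whose mean energy decays uniformly is nowhere dense. -/
theorem isNowhereDense_of_mean_energy_decay (hn : 2 ≤ n) {ν : ℝ} (hν : 0 < ν)
    {A : Set (L2sigma n)}
    (hA : ∀ δ : ℝ, 0 < δ → ∃ K : ℝ, ∀ u₀ ∈ A, ∃ u : ℝ → L2sigma n,
      IsDistributionalSolution ν u₀ u ∧
        ∀ T : ℝ, 0 ≤ T → ∫ t in Icc 0 T, ‖u t‖ ^ 2 ≤ δ * T + K) :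
    IsNowhereDense A := by
  obtain ⟨ψ, hψ, hψc, hdiv, x₀, hx₀⟩ := exists_solenoidal_field hn
  obtain ⟨C, hC, hbound⟩ := exists_abs_integral_inner_rescale_le hn hν hψ hψc hdiv
  rw [IsNowhereDense, eq_empty_iff_forall_notMem]
  intro v hv
  obtain ⟨r, hr, hball⟩ := Metric.mem_nhds_iff.1 (mem_interior_iff_mem_nhds.1 hv)
  set W := ∫ x, ‖ψ x‖ ^ 2 with hW
  have hWpos : 0 < W := by
    refine (hψ.continuous.norm.pow 2).integral_pos_of_hasCompactSupport_nonneg_nonzero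
      (hψc.norm.comp_left (g := fun y : ℝ => y ^ 2) (by simp)) (fun x => by positivity) (x := x₀) ?_
    simpa using hx₀
  -- As `‖w‖ = √W` at every scale, the step `ρ • w` has length `r / 2` and stays in the ball.
  set ρ := r / (2 * √W) with hρ
  have hsW : 0 < √W := Real.sqrt_pos.2 hWpos
  have hρpos : 0 < ρ := by positivity
  -- Makes the bound `C * (2 * δ)` equal to `ρ * W / 4`, while the pairings at `v` and `v + ρ • w`
  -- differ by `ρ * W`.
  set δ := ρ * W / (8 * C) with hδ
  have hδpos : 0 < δ := by positivity
  -- With `η = δ / 2` in `setIntegral_norm_add_sq_le`, this rate makes the total coefficient of `T`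
  -- equal to `δ`.
  obtain ⟨K, hK⟩ := hA (δ / 2 / ((δ / 2)⁻¹ + 1)) (by positivity)
  set K' := ((δ / 2)⁻¹ + 1) * |K| with hK'
  have hK'0 : 0 ≤ K' := by positivity
  -- Small enough that the constant part `K'`, averaged over time `l⁻²`, contributes at most `δ`.
  set l := √(δ / (K' + 1 + δ)) with hl
  have hq : 0 < δ / (K' + 1 + δ) := by positivity
  have hlpos : 0 < l := Real.sqrt_pos.2 hq
  have hlsq : l ^ 2 = δ / (K' + 1 + δ) := Real.sq_sqrt hq.le
  have hl1 : l ≤ 1 := by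
    rw [hl, Real.sqrt_le_left zero_le_one, one_pow, div_le_one (by positivity)]
    linarith
  have hKl : K' * l ^ 2 ≤ δ := by
    rw [hlsq, mul_div_assoc', div_le_iff₀ (by positivity)]
    nlinarith
  have hd : Differentiable ℝ ψ := hψ.differentiable (by simp)
  have hm : MemLp (rescale l ψ) 2 := (contDiff_rescale l hψ).continuous.memLp_of_hasCompactSupport
    (hasCompactSupport_rescale hlpos hψc)
  have hw : hm.toLp (rescale l ψ) ∈ L2sigma n := by
    intro φ hφ _
    rw [← integral_fderiv_apply_eq_zero (contDiff_rescale l hψ)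
      (hasCompactSupport_rescale hlpos hψc)
      (fun x => by rw [divergence_rescale l hd, hdiv, mul_zero]) hφ]
    refine integral_congr_ae ?_
    filter_upwards [hm.coeFn_toLp] with x hx
    rw [hx]
  let w : L2sigma n := ⟨hm.toLp (rescale l ψ), hw⟩
  have hwsq : ‖w‖ ^ 2 = W := by
    rw [hW, ← integral_norm_sq_rescale hlpos ψ]
    exact norm_sq_toLp_eq_integral hm
  have hwn : ‖w‖ = √W := by rw [← hwsq, Real.sqrt_sq (norm_nonneg _)]
  -- Pairing with the fixed `w` is continuous, so the bound reaches the closure without any limit of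
  -- solutions.
  have hest : ∀ u₀ ∈ closure A, |inner ℝ u₀ w| ≤ C * (2 * δ) := by
    refine closure_minimal (fun u₀ hu₀ => ?_)
      (isClosed_le (by fun_prop) continuous_const : IsClosed {u₀ : L2sigma n | |inner ℝ u₀ w| ≤ _})
    obtain ⟨u, hu, hE⟩ := hK u₀ hu₀
    have h1 := hbound l hlpos hl1 u₀ u hu
    rw [integral_inner_eq_inner_toLp _ hm] at h1
    have hT : 0 ≤ (l ^ 2)⁻¹ := by positivity
    have h2 := setIntegral_norm_add_sq_le hT (half_pos hδpos) (hu.locally_L2 _)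
    have h3 := hE _ hT
    refine h1.trans ?_
    rw [mul_assoc]
    refine mul_le_mul_of_nonneg_left ?_ hC.le
    have h4 : ((δ / 2)⁻¹ + 1) * ∫ t in Icc 0 (l ^ 2)⁻¹, ‖u t‖ ^ 2
        ≤ δ / 2 * (l ^ 2)⁻¹ + K' := by
      calc ((δ / 2)⁻¹ + 1) * ∫ t in Icc 0 (l ^ 2)⁻¹, ‖u t‖ ^ 2
          ≤ ((δ / 2)⁻¹ + 1) * (δ / 2 / ((δ / 2)⁻¹ + 1) * (l ^ 2)⁻¹ + |K|) := by
            gcongr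
            exact h3.trans (by gcongr; exact le_abs_self K)
        _ = δ / 2 * (l ^ 2)⁻¹ + K' := by
            rw [hK']
            field_simp
    calc l ^ 2 * ∫ t in Icc 0 (l ^ 2)⁻¹, (‖u t‖ + ‖u t‖ ^ 2)
        ≤ l ^ 2 * (δ / 2 * (l ^ 2)⁻¹ + (δ / 2 * (l ^ 2)⁻¹ + K')) := by
          gcongr
          linarith
      _ = δ + K' * l ^ 2 := by
          field_simp
          ring
      _ ≤ 2 * δ := by linarith
  have hmem : v + ρ • w ∈ closure A := by
    refine hball ?_
    rw [mem_ball_iff_norm, add_sub_cancel_left, norm_smul, hwn, Real.norm_of_nonneg hρpos.le, hρ]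
    have : r / (2 * √W) * √W = r / 2 := by field_simp
    linarith
  have h1 := abs_le.1 (hest _ hmem)
  have h2 := abs_le.1 (hest _ (interior_subset hv))
  have h0 : inner ℝ (ρ • w) w = ρ * inner ℝ w w := real_inner_smul_left w w ρ
  rw [inner_add_left, h0, real_inner_self_eq_norm_sq, hwsq] at h1
  have h3 : C * (2 * δ) = ρ * W / 4 := by
    rw [hδ]
    field_simp
    norm_num
  have h4 : 0 < ρ * W := by positivity
  linarith [h1.2, h2.1]

/-! ### Algebraic decay and `L^p` bounds -/

theorem two_mul_energy (v : L2sigma n) : 2 * energy v = ‖v‖ ^ 2 := by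
  rw [energy, ← norm_sq_eq_integral]
  simp

theorem energy_nonneg (v : L2sigma n) : 0 ≤ energy v := by
  have := two_mul_energy v
  have := sq_nonneg ‖v‖
  linarith

/-- The interval before `S` costs only an additive constant, so only the tail determines the growth
rate in `T`. -/
theorem setIntegral_norm_sq_le_of_ae_tail {E : Type*} [NormedAddCommGroup E] {u : ℝ → E}
    (hu : ∀ T, MemLp u 2 (volume.restrict (Icc 0 T))) {S K b : ℝ} (hb : 0 ≤ b)
    (hK : ∫ t in Icc 0 S, ‖u t‖ ^ 2 ≤ K) (htail : ∀ᵐ t, S < t → ‖u t‖ ^ 2 ≤ b)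
    {T : ℝ} (hT : 0 ≤ T) : ∫ t in Icc 0 T, ‖u t‖ ^ 2 ≤ b * T + K := by
  have hu2 : ∀ T, IntegrableOn (fun t => ‖u t‖ ^ 2) (Icc 0 T) := fun T =>
    (hu T).integrable_norm_pow (by simp)
  have hc : IntegrableOn (fun _ : ℝ => b) (Icc 0 T) := integrableOn_const (by simp)
  have hi : IntegrableOn ((Icc 0 S).indicator fun t => ‖u t‖ ^ 2) (Icc 0 T) :=
    (hu2 T).indicator measurableSet_Icc
  calc ∫ t in Icc 0 T, ‖u t‖ ^ 2
      ≤ ∫ t in Icc 0 T, (b + (Icc 0 S).indicator (fun t => ‖u t‖ ^ 2) t) := by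
        refine setIntegral_mono_on_ae (hu2 T) (hc.add hi) measurableSet_Icc ?_
        filter_upwards [htail] with t ht htT
        by_cases h : t ∈ Icc 0 S
        · rw [indicator_of_mem h]
          linarith
        · rw [indicator_of_notMem h, add_zero]
          exact ht (by
            by_contra! hS
            exact h ⟨htT.1, hS⟩)
    _ = b * T + ∫ t in Icc 0 T ∩ Icc 0 S, ‖u t‖ ^ 2 := by
        rw [integral_add hc hi, setIntegral_indicator measurableSet_Icc, setIntegral_const]
        simp [hT, mul_comm]
    _ ≤ b * T + ∫ t in Icc 0 S, ‖u t‖ ^ 2 := by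
        refine add_le_add le_rfl ?_
        exact setIntegral_mono_set (hu2 S) (Eventually.of_forall fun t => sq_nonneg ‖u t‖)
          (inter_subset_right.eventuallyLE)
    _ ≤ b * T + K := by gcongr

theorem norm_sq_le_of_mul_energy_le {v : L2sigma n} {a C b : ℝ} (ha : 0 < a) (hab : 2 * C ≤ b * a)
    (h : a * energy v ≤ C) : ‖v‖ ^ 2 ≤ b := by
  have h1 : a * ‖v‖ ^ 2 ≤ a * b := by
    rw [← two_mul_energy]
    linarith
  exact le_of_mul_le_mul_left h1 ha

/-- Decay is asked only after `S`, with `K` controlling the earlier times. This form serves both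
uniform decay from time 0 and decay that starts at an unknown time. -/
theorem isNowhereDense_algebraic_decay (hn : 2 ≤ n) {ν : ℝ} (hν : 0 < ν) {S : ℝ} (hS : 1 ≤ S)
    (K : ℝ) {ε C : ℝ} (hε : 0 < ε) (hC : 0 < C) :
    IsNowhereDense {u₀ : L2sigma n | ∃ u : ℝ → L2sigma n, IsDistributionalSolution ν u₀ u ∧
      ∫ t in Icc 0 S, ‖u t‖ ^ 2 ≤ K ∧ ∀ᵐ t : ℝ, S < t → t ^ ε * energy (u t) ≤ C} := by
  refine isNowhereDense_of_mean_energy_decay hn hν fun δ hδ => ?_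
  obtain ⟨R, hR⟩ := eventually_atTop.1 ((tendsto_rpow_atTop hε).eventually_ge_atTop (2 * C / δ))
  -- On `(S, max R S]` only `‖u‖² ≤ 2 * C` is used, available because `S ≥ 1` gives `t ^ ε ≥ 1`;
  -- after `R` the bound improves to `δ`.
  refine ⟨2 * C * max R S + K, fun u₀ hu₀ => ?_⟩
  obtain ⟨u, hu, hK, htail⟩ := hu₀
  refine ⟨u, hu, fun T hT => setIntegral_norm_sq_le_of_ae_tail hu.locally_L2 (S := max R S) hδ.le
    (setIntegral_norm_sq_le_of_ae_tail hu.locally_L2 (by positivity) hK ?_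
      (le_max_of_le_right (by linarith))) ?_ hT⟩
  · filter_upwards [htail] with t ht hSt
    have h1 : 1 ≤ t ^ ε := Real.one_le_rpow (by linarith) hε.le
    exact norm_sq_le_of_mul_energy_le (by linarith) (by nlinarith) (ht hSt)
  · filter_upwards [htail] with t ht hRt
    have hSt : S < t := (le_max_right _ _).trans_lt hRt
    have h1 : 0 < t ^ ε := Real.rpow_pos_of_pos (by linarith) _
    have h2 := hR t ((le_max_left _ _).trans hRt.le)
    rw [div_le_iff₀' hδ] at h2
    exact norm_sq_le_of_mul_energy_le h1 h2 (ht hSt)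

/-- When `s² ≥ δ`, write `s² = (s²)^((2 - p)/2) * s^p`; the exponent `(2 - p)/2` is negative, so the
first factor is largest at `s² = δ`. -/
theorem sq_le_add_rpow {p δ s : ℝ} (hp : 2 < p) (hδ : 0 < δ) (hs : 0 ≤ s) :
    s ^ 2 ≤ δ + δ ^ ((2 - p) / 2) * s ^ p := by
  rcases le_total (s ^ 2) δ with h | h
  · have : 0 ≤ δ ^ ((2 - p) / 2) * s ^ p := by positivity
    linarith
  · have hs0 : 0 < s := by
      refine hs.lt_of_ne fun h0 => ?_
      rw [← h0] at h
      norm_num at h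
      linarith
    have h1 : s ^ 2 = (s ^ 2) ^ ((2 - p) / 2) * s ^ p := by
      rw [← Real.rpow_natCast s 2, ← Real.rpow_mul hs, ← Real.rpow_add hs0]
      congr 1
      push_cast
      ring
    have h2 : (s ^ 2) ^ ((2 - p) / 2) ≤ δ ^ ((2 - p) / 2) :=
      Real.rpow_le_rpow_of_nonpos hδ h (by linarith)
    have h3 : (s ^ 2) ^ ((2 - p) / 2) * s ^ p ≤ δ ^ ((2 - p) / 2) * s ^ p := by gcongr
    linarith

theorem isNowhereDense_eLpNorm_le (hn : 2 ≤ n) {ν : ℝ} (hν : 0 < ν) {p M : ℝ} (hp : 2 < p)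
    (hM : 0 < M) :
    IsNowhereDense {u₀ : L2sigma n | ∃ u : ℝ → L2sigma n, IsDistributionalSolution ν u₀ u ∧
      eLpNorm u (ENNReal.ofReal p) (volume.restrict (Ici 0)) ≤ ENNReal.ofReal M} := by
  refine isNowhereDense_of_mean_energy_decay hn hν fun δ hδ => ?_
  refine ⟨δ ^ ((2 - p) / 2) * M ^ p, fun u₀ ⟨u, hu, hle⟩ => ⟨u, hu, fun T hT => ?_⟩⟩
  have hp0 : 0 < p := by linarith
  have hle' : eLpNorm u (ENNReal.ofReal p) (volume.restrict (Icc 0 T)) ≤ ENNReal.ofReal M :=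
    (eLpNorm_mono_measure u (Measure.restrict_mono Icc_subset_Ici_self le_rfl)).trans hle
  have hup : MemLp u (ENNReal.ofReal p) (volume.restrict (Icc 0 T)) :=
    ⟨(hu.locally_L2 T).1, hle'.trans_lt ENNReal.ofReal_lt_top⟩
  have hne : ENNReal.ofReal p ≠ 0 := by simpa using hp0
  have hip : IntegrableOn (fun t => ‖u t‖ ^ p) (Icc 0 T) := by
    have h := hup.integrable_norm_rpow hne ENNReal.ofReal_ne_top
    rwa [ENNReal.toReal_ofReal hp0.le] at h
  have hu2 : IntegrableOn (fun t => ‖u t‖ ^ 2) (Icc 0 T) :=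
    (hu.locally_L2 T).integrable_norm_pow (by simp)
  have hc : IntegrableOn (fun _ : ℝ => δ) (Icc 0 T) := integrableOn_const (by simp)
  have hIp : ∫ t in Icc 0 T, ‖u t‖ ^ p ≤ M ^ p := by
    rw [hup.eLpNorm_eq_integral_rpow_norm hne ENNReal.ofReal_ne_top,
      ENNReal.toReal_ofReal hp0.le, ENNReal.ofReal_le_ofReal_iff hM.le,
      Real.rpow_inv_le_iff_of_pos (integral_nonneg fun t => by positivity) hM.le hp0] at hle'
    exact hle'
  calc ∫ t in Icc 0 T, ‖u t‖ ^ 2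
      ≤ ∫ t in Icc 0 T, (δ + δ ^ ((2 - p) / 2) * ‖u t‖ ^ p) :=
        integral_mono hu2 (hc.add (hip.const_mul _)) fun t =>
          sq_le_add_rpow hp hδ (norm_nonneg _)
    _ = δ * T + δ ^ ((2 - p) / 2) * ∫ t in Icc 0 T, ‖u t‖ ^ p := by
        rw [integral_add hc (hip.const_mul _), integral_const_mul, setIntegral_const]
        simp [hT, mul_comm]
    _ ≤ δ * T + δ ^ ((2 - p) / 2) * M ^ p := by gcongr

theorem isNowhereDense_one_add_rpow_energy_le (hn : 2 ≤ n) {ν : ℝ} (hν : 0 < ν) {ε C : ℝ}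
    (hε : 0 < ε) (hC : 0 < C) :
    IsNowhereDense {u₀ : L2sigma n | ∃ u : ℝ → L2sigma n, IsDistributionalSolution ν u₀ u ∧
      ∀ᵐ t ∂(volume.restrict (Ici (0 : ℝ))), (1 + t) ^ ε * energy (u t) ≤ C} := by
  -- On `[0, 1]` the weight is at least 1, so `‖u‖² ≤ 2 * C` there; later `t ^ ε ≤ (1 + t) ^ ε`.
  refine IsNowhereDense.mono ?_ (isNowhereDense_algebraic_decay hn hν le_rfl (2 * C) hε hC)
  rintro u₀ ⟨u, hu, hdecay⟩
  rw [ae_restrict_iff' measurableSet_Ici] at hdecay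
  have hu2 : IntegrableOn (fun t => ‖u t‖ ^ 2) (Icc 0 1) :=
    (hu.locally_L2 1).integrable_norm_pow (by simp)
  refine ⟨u, hu, ?_, ?_⟩
  · calc ∫ t in Icc (0 : ℝ) 1, ‖u t‖ ^ 2 ≤ ∫ t in Icc (0 : ℝ) 1, 2 * C := by
          refine setIntegral_mono_on_ae hu2 (integrableOn_const (by simp)) measurableSet_Icc ?_
          filter_upwards [hdecay] with t ht htI
          have h1 : 1 ≤ (1 + t) ^ ε := Real.one_le_rpow (by linarith [htI.1]) hε.le
          exact norm_sq_le_of_mul_energy_le (by linarith) (by nlinarith) (ht htI.1)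
      _ = 2 * C := by simp
  · filter_upwards [hdecay] with t ht h1
    refine le_trans ?_ (ht (by simp; linarith))
    have := energy_nonneg (u t)
    gcongr
    linarith

/-! ### Generic data -/

theorem residual_tendsto_eLpNorm_rpow_mul_energy (hn : 2 ≤ n) {ν : ℝ} (hν : 0 < ν) :
    ∀ᶠ u₀ in residual (L2sigma n), ∀ u : ℝ → L2sigma n, IsDistributionalSolution ν u₀ u →
      ∀ ε : ℝ, 0 < ε → Tendsto
        (fun τ : ℝ => eLpNorm (fun t : ℝ => t ^ ε * energy (u t)) ⊤ (volume.restrict (Ioi τ)))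
        atTop (𝓝 ⊤) := by
  -- `k.1 + 1` is at once the starting time, the inverse exponent and the decay constant, since
  -- enlarging each only weakens the condition. `k.2` bounds the energy integral before that time.
  have hmeagre : IsMeagre (⋃ k : ℕ × ℕ, {u₀ : L2sigma n | ∃ u : ℝ → L2sigma n,
      IsDistributionalSolution ν u₀ u ∧ ∫ t in Icc 0 (k.1 + 1 : ℝ), ‖u t‖ ^ 2 ≤ k.2 ∧
      ∀ᵐ t : ℝ, (k.1 + 1 : ℝ) < t → t ^ ((k.1 + 1 : ℝ)⁻¹) * energy (u t) ≤ k.1 + 1}) :=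
    isMeagre_iUnion fun k => (isNowhereDense_algebraic_decay hn hν (by simp) _
      (by positivity) (by positivity)).isMeagre
  filter_upwards [hmeagre] with u₀ hu₀ u hu ε hε
  rw [ENNReal.tendsto_nhds_top_iff_nnreal]
  by_contra! h
  obtain ⟨x, hx⟩ := h
  -- A single `τ` with norm at most `x` already gives algebraic decay after `τ`.
  obtain ⟨τ, hτ⟩ := hx.exists
  rw [eLpNorm_exponent_top] at hτ
  obtain ⟨N, hN⟩ := exists_nat_ge (max (max τ x) ε⁻¹)
  obtain ⟨m, hm⟩ := exists_nat_ge (∫ t in Icc 0 (N + 1 : ℝ), ‖u t‖ ^ 2)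
  refine hu₀ (mem_iUnion.2 ⟨(N, m), u, hu, hm, ?_⟩)
  have hτN : τ ≤ N := (le_max_left _ _).trans ((le_max_left _ _).trans hN)
  have hxN : (x : ℝ) ≤ N := (le_max_right _ _).trans ((le_max_left _ _).trans hN)
  have hεN : ε⁻¹ ≤ N := (le_max_right _ _).trans hN
  have hae := ae_le_eLpNormEssSup (f := fun t : ℝ => t ^ ε * energy (u t))
    (μ := volume.restrict (Ioi τ))
  rw [ae_restrict_iff' measurableSet_Ioi] at hae
  filter_upwards [hae] with t ht hNt
  have hN0 : (0 : ℝ) ≤ N := N.cast_nonneg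
  have h1 := (ht (by simp only [mem_Ioi]; linarith)).trans hτ
  have hE := energy_nonneg (u t)
  have h2 : t ^ ε * energy (u t) ≤ x := by
    rw [enorm_le_coe] at h1
    exact (le_abs_self _).trans (NNReal.coe_le_coe.2 h1)
  have h3 : t ^ ((N + 1 : ℝ)⁻¹) ≤ t ^ ε := by
    refine Real.rpow_le_rpow_of_exponent_le (by linarith) ?_
    rw [inv_le_comm₀ (by positivity) hε]
    linarith
  calc t ^ ((N + 1 : ℝ)⁻¹) * energy (u t) ≤ t ^ ε * energy (u t) := by gcongr
    _ ≤ N + 1 := by linarith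

end NavierStokes

theorem mainTheorem8 (n : ℕ) (hn : 2 ≤ n) (ν : ℝ) (hν : 0 < ν) :
    (∀ p M : ℝ, 2 < p → 0 < M →
      IsNowhereDense {u₀ : NavierStokes.L2sigma n |
        ∃ u : ℝ → NavierStokes.L2sigma n,
          NavierStokes.IsDistributionalSolution ν u₀ u ∧
          eLpNorm u (ENNReal.ofReal p) (volume.restrict (Ici 0)) ≤ ENNReal.ofReal M}) ∧
    (∀ ε C : ℝ, 0 < ε → 0 < C →
      IsNowhereDense {u₀ : NavierStokes.L2sigma n |
        ∃ u : ℝ → NavierStokes.L2sigma n,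
          NavierStokes.IsDistributionalSolution ν u₀ u ∧
          ∀ᵐ t ∂(volume.restrict (Ici (0 : ℝ))),
            (1 + t) ^ ε * NavierStokes.energy (u t) ≤ C}) ∧
    (∀ᶠ u₀ in residual (NavierStokes.L2sigma n),
      ∀ u : ℝ → NavierStokes.L2sigma n,
        NavierStokes.IsDistributionalSolution ν u₀ u →
        ∀ ε : ℝ, 0 < ε →
          Tendsto
            (fun τ : ℝ => eLpNorm (fun t : ℝ => t ^ ε * NavierStokes.energy (u t)) ⊤
              (volume.restrict (Ioi τ)))
            atTop (𝓝 ⊤)) := ⟨fun _ _ hp hM => NavierStokes.isNowhereDense_eLpNorm_le hn hν hp hM,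
    fun _ _ hε hC => NavierStokes.isNowhereDense_one_add_rpow_energy_le hn hν hε hC,
    NavierStokes.residual_tendsto_eLpNorm_rpow_mul_energy hn hν⟩
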